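/- Let $\mu=(\mu_1,\dots,\mu_n)$ and $\nu=(\nu_1,\dots,\nu_n)$ be partitions, written with the same number $n$ of parts (zero parts allowed). Define $(\mu,\nu)^*=(\lambda,\rho)$, where $\lambda=(\lambda_1,\dots,\lambda_n)$ and $\rho=(\rho_1,\dots,\rho_n)$ are the partitions given by $$\lambda_k=\mu_k-k+\#\{j : 1\le j\le n,\ \nu_j-j\ge\mu_k-k\},$$ $$\rho_j=\nu_j-j+1+\#\{k : 1\le k\le n,\ \mu_k-k>\nu_j-j\}$$ (up to zero parts, this does not depend on the choice of $n$). Let $s_\theta$ denote the Schur function indexed by the partition $\theta$, and call a symmetric function Schur positive if it is a finite linear combination of Schur functions with non-negative integer coefficients. Say that the Fomin–Fulton–Li–Poon conjecture holds for the ordered pair $(\mu,\nu)$ if, with $(\lambda,\rho)=(\mu,\nu)^*$, the symmetric function $$s_\lambda s_\rho-s_\mu s_\nu$$ is Schur positive. Let $\theta'$ denote the conjugate of a partition $\theta$. Proposition. For all partitions $\mu$ and $\nu$, the conjecture holds for the pair $(\mu,\nu)$ if and only if it holds for the pair $(\nu',\mu')$. -/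

import Mathlib

/-!
Partitions are Mathlib's `YoungDiagram`s: `μ.rowLen i` is the part `μ_{i+1}` (parts are padded by
zeros), `μ.colLen 0` is the number of nonzero parts and `μ.transpose` is the conjugate `μ'`.
-/

namespace FFLP

section Star

/-- The part `λ_{k+1}` of the first component of `(μ, ν)^*`, where `μ` and `ν` are written with `n`
parts: `μ_k - k + #{j | 1 ≤ j ≤ n, ν_j - j ≥ μ_k - k}` (here with indices starting at `0`). -/
def leftPart (n : ℕ) (μ ν : YoungDiagram) (k : ℕ) : ℤ :=
  (μ.rowLen k : ℤ) - ((k : ℤ) + 1) +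
    (((Finset.range n).filter fun j : ℕ =>
      (μ.rowLen k : ℤ) - ((k : ℤ) + 1) ≤ (ν.rowLen j : ℤ) - ((j : ℤ) + 1)).card : ℤ)

/-- The part `ρ_{j+1}` of the second component of `(μ, ν)^*`, where `μ` and `ν` are written with `n`
parts: `ν_j - j + 1 + #{k | 1 ≤ k ≤ n, μ_k - k > ν_j - j}` (here with indices starting at `0`). -/
def rightPart (n : ℕ) (μ ν : YoungDiagram) (j : ℕ) : ℤ :=
  (ν.rowLen j : ℤ) - ((j : ℤ) + 1) + 1 +
    (((Finset.range n).filter fun k : ℕ =>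
      (ν.rowLen j : ℤ) - ((j : ℤ) + 1) < (μ.rowLen k : ℤ) - ((k : ℤ) + 1)).card : ℤ)

/-- The number of `j < n` with `ν_j - j ≥ b` exceeds the number of those with `ν_j - j ≥ a` by at
most `a - b`, since the integers `ν_j - j` are distinct. -/
theorem card_filter_le (n : ℕ) (ν : YoungDiagram) {a b : ℤ} (hab : b ≤ a) :
    (((Finset.range n).filter fun j : ℕ => b ≤ (ν.rowLen j : ℤ) - ((j : ℤ) + 1)).card : ℤ) ≤
      (((Finset.range n).filter fun j : ℕ => a ≤ (ν.rowLen j : ℤ) - ((j : ℤ) + 1)).card : ℤ)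
        + (a - b) := by
  have hsub : ((Finset.range n).filter fun j : ℕ => b ≤ (ν.rowLen j : ℤ) - ((j : ℤ) + 1)) ⊆
      ((Finset.range n).filter fun j : ℕ => a ≤ (ν.rowLen j : ℤ) - ((j : ℤ) + 1)) ∪
      ((Finset.range n).filter fun j : ℕ =>
        (ν.rowLen j : ℤ) - ((j : ℤ) + 1) ∈ Finset.Ico b a) := by
    intro j hj
    simp only [Finset.mem_union, Finset.mem_filter, Finset.mem_Ico] at hj ⊢
    rcases le_or_gt a ((ν.rowLen j : ℤ) - ((j : ℤ) + 1)) with h | h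
    · exact Or.inl ⟨hj.1, h⟩
    · exact Or.inr ⟨hj.1, hj.2, h⟩
  have hinj : ((Finset.range n).filter fun j : ℕ =>
      (ν.rowLen j : ℤ) - ((j : ℤ) + 1) ∈ Finset.Ico b a).card ≤ (Finset.Ico b a).card := by
    apply Finset.card_le_card_of_injOn (fun j : ℕ => (ν.rowLen j : ℤ) - ((j : ℤ) + 1))
    · intro j hj
      simpa using (Finset.mem_filter.1 hj).2
    · intro i _ j _ hij
      simp only at hij
      rcases lt_trichotomy i j with h | h | h
      · have := ν.rowLen_anti i j h.le
        omega
      · exact h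
      · have := ν.rowLen_anti j i h.le
        omega
  have h1 := (Finset.card_le_card hsub).trans (Finset.card_union_le _ _)
  rw [Int.card_Ico] at hinj
  omega

theorem leftPart_anti (n : ℕ) (μ ν : YoungDiagram) {k l : ℕ} (h : k ≤ l) :
    leftPart n μ ν l ≤ leftPart n μ ν k := by
  have h1 := μ.rowLen_anti k l h
  have h2 := card_filter_le n ν (a := (μ.rowLen k : ℤ) - ((k : ℤ) + 1))
    (b := (μ.rowLen l : ℤ) - ((l : ℤ) + 1)) (by omega)
  unfold leftPart
  omega

theorem rightPart_anti (n : ℕ) (μ ν : YoungDiagram) {k l : ℕ} (h : k ≤ l) :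
    rightPart n μ ν l ≤ rightPart n μ ν k := by
  have h1 := ν.rowLen_anti k l h
  have h2 := card_filter_le n μ (a := (ν.rowLen k : ℤ) - ((k : ℤ) + 1) + 1)
    (b := (ν.rowLen l : ℤ) - ((l : ℤ) + 1) + 1) (by omega)
  simp only [Int.add_one_le_iff] at h2
  unfold rightPart
  omega

theorem rowLen_eq_zero {μ : YoungDiagram} {i : ℕ} (h : μ.colLen 0 ≤ i) : μ.rowLen i = 0 := by
  by_contra h0
  have h1 : (i, 0) ∈ μ := YoungDiagram.mem_iff_lt_rowLen.2 (Nat.pos_of_ne_zero h0)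
  have h2 := YoungDiagram.mem_iff_lt_colLen.1 h1
  omega

theorem leftPart_nonneg {n : ℕ} (μ ν : YoungDiagram) {k : ℕ} (hk : k < n) :
    0 ≤ leftPart n μ ν k := by
  rcases Nat.eq_zero_or_pos (μ.rowLen k) with h0 | h0
  · have hsub : Finset.range (k + 1) ⊆ (Finset.range n).filter fun j : ℕ =>
        (μ.rowLen k : ℤ) - ((k : ℤ) + 1) ≤ (ν.rowLen j : ℤ) - ((j : ℤ) + 1) := by
      intro j hj
      simp only [Finset.mem_range, Finset.mem_filter] at hj ⊢
      omega
    have := Finset.card_le_card hsub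
    rw [Finset.card_range] at this
    unfold leftPart
    omega
  · by_cases hμ : (k : ℤ) + 1 ≤ μ.rowLen k
    · unfold leftPart
      omega
    · have hsub : Finset.range (k + 1 - μ.rowLen k) ⊆ (Finset.range n).filter fun j : ℕ =>
          (μ.rowLen k : ℤ) - ((k : ℤ) + 1) ≤ (ν.rowLen j : ℤ) - ((j : ℤ) + 1) := by
        intro j hj
        simp only [Finset.mem_range, Finset.mem_filter] at hj ⊢
        omega
      have := Finset.card_le_card hsub
      rw [Finset.card_range] at this
      unfold leftPart
      omega

theorem rightPart_nonneg {n : ℕ} (μ ν : YoungDiagram) {j : ℕ} (hj : j < n) :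
    0 ≤ rightPart n μ ν j := by
  by_cases hν : (j : ℤ) ≤ ν.rowLen j
  · unfold rightPart
    omega
  · have hsub : Finset.range (j - ν.rowLen j) ⊆ (Finset.range n).filter fun k : ℕ =>
        (ν.rowLen j : ℤ) - ((j : ℤ) + 1) < (μ.rowLen k : ℤ) - ((k : ℤ) + 1) := by
      intro k hk
      simp only [Finset.mem_range, Finset.mem_filter] at hk ⊢
      omega
    have := Finset.card_le_card hsub
    rw [Finset.card_range] at this
    unfold rightPart
    omega

/-- A common number of parts, allowing zero parts, for `μ` and `ν`. -/
def numParts (μ ν : YoungDiagram) : ℕ := max (μ.colLen 0) (ν.colLen 0)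

/-- The first component `λ(μ, ν)` of `(μ, ν)^*`. -/
def starLeft (μ ν : YoungDiagram) : YoungDiagram :=
  YoungDiagram.ofRowLens
    ((List.range (numParts μ ν)).map fun k => (leftPart (numParts μ ν) μ ν k).toNat)
    (by
      refine List.Pairwise.sortedGE (List.pairwise_map.2 (List.pairwise_lt_range.imp ?_))
      intro k l h
      exact Int.toNat_le_toNat (leftPart_anti _ μ ν h.le))

/-- The second component `ρ(μ, ν)` of `(μ, ν)^*`. -/
def starRight (μ ν : YoungDiagram) : YoungDiagram :=
  YoungDiagram.ofRowLens
    ((List.range (numParts μ ν)).map fun j => (rightPart (numParts μ ν) μ ν j).toNat)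
    (by
      refine List.Pairwise.sortedGE (List.pairwise_map.2 (List.pairwise_lt_range.imp ?_))
      intro k l h
      exact Int.toNat_le_toNat (rightPart_anti _ μ ν h.le))

/-- The `*`-operation `(μ, ν) ↦ (λ(μ, ν), ρ(μ, ν))` on ordered pairs of partitions. -/
def star (μ ν : YoungDiagram) : YoungDiagram × YoungDiagram := (starLeft μ ν, starRight μ ν)

/-- Appending zero parts does not change the parts of `λ(μ, ν)`. -/
theorem leftPart_succ {n : ℕ} {μ ν : YoungDiagram} (hν : ν.colLen 0 ≤ n) {k : ℕ} (hk : k < n) :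
    leftPart (n + 1) μ ν k = leftPart n μ ν k := by
  have h0 := rowLen_eq_zero hν
  unfold leftPart
  rw [Finset.range_add_one, Finset.filter_insert, if_neg (by omega)]

theorem leftPart_last {n : ℕ} {μ ν : YoungDiagram} (hμ : μ.colLen 0 ≤ n) :
    leftPart (n + 1) μ ν n = 0 := by
  have h0 := rowLen_eq_zero hμ
  unfold leftPart
  rw [Finset.filter_true_of_mem, Finset.card_range]
  · omega
  · intro j hj
    rw [Finset.mem_range] at hj
    omega

/-- Appending zero parts does not change the parts of `ρ(μ, ν)`. -/
theorem rightPart_succ {n : ℕ} {μ ν : YoungDiagram} (hμ : μ.colLen 0 ≤ n) {j : ℕ} (hj : j < n) :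
    rightPart (n + 1) μ ν j = rightPart n μ ν j := by
  have h0 := rowLen_eq_zero hμ
  unfold rightPart
  rw [Finset.range_add_one, Finset.filter_insert, if_neg (by omega)]

theorem rightPart_last {n : ℕ} {μ ν : YoungDiagram} (hμ : μ.colLen 0 ≤ n) (hν : ν.colLen 0 ≤ n) :
    rightPart (n + 1) μ ν n = 0 := by
  have h0 := rowLen_eq_zero hν
  have h1 := rowLen_eq_zero hμ
  unfold rightPart
  rw [Finset.range_add_one, Finset.filter_insert, if_neg (by omega), Finset.filter_true_of_mem,
    Finset.card_range]
  · omega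
  · intro j hj
    rw [Finset.mem_range] at hj
    omega

theorem rowLen_ofRowLens_map (n : ℕ) (f : ℕ → ℕ) (h : ((List.range n).map f).SortedGE) (k : ℕ) :
    (YoungDiagram.ofRowLens ((List.range n).map f) h).rowLen k = if k < n then f k else 0 := by
  split_ifs with hk
  · have := YoungDiagram.rowLen_ofRowLens (hw := h) ⟨k, by simpa using hk⟩
    simpa using this
  · by_contra h0
    have h1 := YoungDiagram.mem_iff_lt_rowLen.2 (Nat.pos_of_ne_zero h0)
    rw [YoungDiagram.mem_ofRowLens] at h1
    obtain ⟨h2, -⟩ := h1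
    simp only [List.length_map, List.length_range] at h2
    exact hk h2

/-- `λ(μ, ν)` has the defining parts, whatever common number `n` of parts `μ` and `ν` are written
with. -/
theorem rowLen_starLeft {μ ν : YoungDiagram} {n k : ℕ} (hn : numParts μ ν ≤ n) (hk : k < n) :
    ((starLeft μ ν).rowLen k : ℤ) = leftPart n μ ν k := by
  induction n, hn using Nat.le_induction with
  | base =>
    rw [starLeft, rowLen_ofRowLens_map, if_pos hk, Int.toNat_of_nonneg (leftPart_nonneg μ ν hk)]
  | succ n hn ih =>
    have hμ : μ.colLen 0 ≤ n := (le_max_left _ _).trans hn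
    have hν : ν.colLen 0 ≤ n := (le_max_right _ _).trans hn
    rcases Nat.lt_succ_iff_lt_or_eq.1 hk with h | rfl
    · rw [leftPart_succ hν h, ih h]
    · rw [leftPart_last hμ, starLeft, rowLen_ofRowLens_map, if_neg (not_lt.2 hn), Nat.cast_zero]

/-- `ρ(μ, ν)` has the defining parts, whatever common number `n` of parts `μ` and `ν` are written
with. -/
theorem rowLen_starRight {μ ν : YoungDiagram} {n j : ℕ} (hn : numParts μ ν ≤ n) (hj : j < n) :
    ((starRight μ ν).rowLen j : ℤ) = rightPart n μ ν j := by
  induction n, hn using Nat.le_induction with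
  | base =>
    rw [starRight, rowLen_ofRowLens_map, if_pos hj, Int.toNat_of_nonneg (rightPart_nonneg μ ν hj)]
  | succ n hn ih =>
    have hμ : μ.colLen 0 ≤ n := (le_max_left _ _).trans hn
    have hν : ν.colLen 0 ≤ n := (le_max_right _ _).trans hn
    rcases Nat.lt_succ_iff_lt_or_eq.1 hj with h | rfl
    · rw [rightPart_succ hμ h, ih h]
    · rw [rightPart_last hμ hν, starRight, rowLen_ofRowLens_map, if_neg (not_lt.2 hn),
        Nat.cast_zero]

end Star

section Schur

/-- The content (type) of a semistandard tableau: `content T m` is the number of entries equal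
to `m`. -/
noncomputable def content {μ : YoungDiagram} (T : SemistandardYoungTableau μ) : ℕ →₀ ℕ :=
  ∑ c ∈ μ.cells, Finsupp.single (T c.1 c.2) 1

/-- There are finitely many semistandard tableaux of given shape and content, so that the
cardinality in the definition of `schur` is a genuine one. -/
theorem finite_content_eq (μ : YoungDiagram) (d : ℕ →₀ ℕ) :
    Finite {T : SemistandardYoungTableau μ // content T = d} := by
  have hmem : ∀ T : {T : SemistandardYoungTableau μ // content T = d}, ∀ c : μ.cells,
      T.1 c.1.1 c.1.2 ∈ d.support := by
    rintro ⟨T, hT⟩ c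
    change T c.1.1 c.1.2 ∈ d.support
    rw [Finsupp.mem_support_iff, ← hT]
    have h1 : (Finsupp.single (T c.1.1 c.1.2) 1 : ℕ →₀ ℕ) ≤ content T :=
      Finset.single_le_sum (f := fun c : ℕ × ℕ => (Finsupp.single (T c.1 c.2) 1 : ℕ →₀ ℕ))
        (fun _ _ => zero_le) c.2
    have h2 := h1 (T c.1.1 c.1.2)
    rw [Finsupp.single_eq_same] at h2
    exact Nat.one_le_iff_ne_zero.1 h2
  refine Finite.of_injective (β := μ.cells → d.support) (fun T c => ⟨T.1 c.1.1 c.1.2, hmem T c⟩) ?_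
  intro T T' h
  apply Subtype.ext
  ext i j
  by_cases hij : (i, j) ∈ μ
  · exact congrArg Subtype.val (congrFun h ⟨(i, j), (YoungDiagram.mem_cells _).2 hij⟩)
  · rw [T.1.zeros hij, T'.1.zeros hij]

/-- The Schur function `s_μ = ∑_T x^T`, the sum over all semistandard tableaux `T` of shape `μ`, as
a formal power series with integer coefficients in the variables `x_0, x_1, x_2, …`: the coefficient
of the monomial `x^d` is the number of semistandard tableaux of shape `μ` and content `d`. -/
noncomputable def schur (μ : YoungDiagram) : MvPowerSeries ℕ ℤ :=
  fun d => (Nat.card {T : SemistandardYoungTableau μ // content T = d} : ℤ)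

/-- `f` is Schur positive: it is a (finite) linear combination of Schur functions with non-negative
integer coefficients. -/
def SchurPositive (f : MvPowerSeries ℕ ℤ) : Prop :=
  ∃ c : YoungDiagram →₀ ℕ, f = c.sum fun θ m => (m : ℤ) • schur θ

end Schur

/-- The Fomin-Fulton-Li-Poon conjecture holds for the pair `(μ, ν)`: if `(μ, ν)^* = (lam, rho)`, then
`s_lam s_rho - s_μ s_ν` is Schur positive. -/
def ConjectureHolds (μ ν : YoungDiagram) : Prop :=
  ∀ lam rho : YoungDiagram, star μ ν = (lam, rho) →
    SchurPositive (schur lam * schur rho - schur μ * schur ν)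

end FFLP

/-! Two facts carry the proof: the star operation commutes with conjugation, and conjugating all
indices (the involution ω) respects products of Schur functions.

For the first, a cell `(k, l)` lies in the left diagram exactly when `k + l + 2 ≤ μ.rowLen k +
ν.colLen l`, and in the right one exactly when `k + l + 1 ≤ ν.rowLen k + μ.colLen l`. Both
conditions survive exchanging `k` with `l` and `(μ, ν)` with `(ν', μ')`, so `(ν', μ')^* = (λ', ρ')`.

For the second, work with the operators that add or remove horizontal strips. Branching of tableaux
identifies extraction of the largest variable with `removeOp`, and the local rule of growth diagrams
moves `removeOp` past `addOp`; induction on the monomial then gives Pieri's rule `schurMap_addOp`. A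
sign-reversing toggle yields `∑ (-1)^i e_{k-i} h_i = 0` at the level of strips, so adding vertical
strips is also multiplication by a fixed series (`exists_schurMap_conj_addOp_conj`). Since the
`addOp k` generate everything from the empty diagram (`eq_top_of_addOp_mem`), conjugation is
multiplicative (`exists_schurMap_mul`). Linear independence (`schurMap_injective`) finally lets
conjugation carry a non-negative expansion of `s_λ s_ρ - s_μ s_ν` to one of its conjugate. -/

namespace FFLP

/-! ### The star operation commutes with conjugation -/

section Conjugation

/-- The number of `j < n` with `ν_j - (j + 1) ≥ a` exceeds `l - a` precisely when the `l`-th column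
of `ν` is longer than `l - a`. -/
theorem sub_lt_card_filter_iff {n : ℕ} {ν : YoungDiagram} (hν : ν.colLen 0 ≤ n) (a : ℤ) (l : ℕ) :
    (l : ℤ) - a < (((Finset.range n).filter fun j : ℕ =>
      a ≤ (ν.rowLen j : ℤ) - ((j : ℤ) + 1)).card : ℤ) ↔ (l : ℤ) - a < ν.colLen l := by
  rcases lt_or_ge ((l : ℤ) - a) 0 with h | h
  · constructor <;> intro _ <;> omega
  obtain ⟨i, hi⟩ := Int.eq_ofNat_of_zero_le h
  rw [hi, Nat.cast_lt, Nat.cast_lt, ← YoungDiagram.mem_iff_lt_colLen]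
  -- The numbers `ν_j - (j + 1)` strictly decrease, so the indices counted form an initial segment;
  -- it has more than `i` elements exactly when it contains `i`. As `l = a + i`, this says that `(i,
  -- l)` is a cell.
  have hmem : (i, l) ∈ ν ↔ i < n ∧ a ≤ (ν.rowLen i : ℤ) - ((i : ℤ) + 1) := by
    rw [YoungDiagram.mem_iff_lt_rowLen]
    constructor
    · intro h1
      have h2 := YoungDiagram.mem_iff_lt_colLen.1
        (ν.up_left_mem le_rfl (Nat.zero_le l) (YoungDiagram.mem_iff_lt_rowLen.2 h1))
      omega
    · omega
  rw [hmem]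
  constructor
  · intro h1
    by_contra h2
    have hsub : ((Finset.range n).filter fun j : ℕ =>
        a ≤ (ν.rowLen j : ℤ) - ((j : ℤ) + 1)) ⊆ Finset.range i := by
      intro j hj
      simp only [Finset.mem_filter, Finset.mem_range] at hj ⊢
      by_contra h3
      have := ν.rowLen_anti i j (not_lt.1 h3)
      exact h2 ⟨by omega, by omega⟩
    have := Finset.card_le_card hsub
    rw [Finset.card_range] at this
    omega
  · rintro ⟨h1, h2⟩
    have hsub : Finset.range (i + 1) ⊆ ((Finset.range n).filter fun j : ℕ =>
        a ≤ (ν.rowLen j : ℤ) - ((j : ℤ) + 1)) := by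
      intro j hj
      simp only [Finset.mem_filter, Finset.mem_range] at hj ⊢
      have := ν.rowLen_anti j i (by omega)
      omega
    have := Finset.card_le_card hsub
    rw [Finset.card_range] at this
    omega

/-- Trading the count for a column length makes rows of `μ` and columns of `ν` enter symmetrically,
so that conjugation becomes visible. -/
theorem mem_starLeft_iff {μ ν : YoungDiagram} {k l : ℕ} :
    (k, l) ∈ starLeft μ ν ↔ k + l + 2 ≤ μ.rowLen k + ν.colLen l := by
  -- Any common number of parts is allowed; one exceeding `k` covers the empty rows too.
  have hn : numParts μ ν ≤ max (numParts μ ν) (k + 1) := le_max_left _ _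
  have h1 := rowLen_starLeft (k := k) hn (by omega)
  have h2 := sub_lt_card_filter_iff (((le_max_right _ _).trans hn : ν.colLen 0 ≤ _))
    ((μ.rowLen k : ℤ) - ((k : ℤ) + 1)) l
  rw [YoungDiagram.mem_iff_lt_rowLen]
  unfold leftPart at h1
  omega

theorem mem_starRight_iff {μ ν : YoungDiagram} {j l : ℕ} :
    (j, l) ∈ starRight μ ν ↔ j + l + 1 ≤ ν.rowLen j + μ.colLen l := by
  have hn : numParts μ ν ≤ max (numParts μ ν) (j + 1) := le_max_left _ _
  have h1 := rowLen_starRight (j := j) hn (by omega)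
  -- The count in `rightPart` is strict, hence the threshold is raised by one.
  have h2 := sub_lt_card_filter_iff (((le_max_left _ _).trans hn : μ.colLen 0 ≤ _))
    ((ν.rowLen j : ℤ) - ((j : ℤ) + 1) + 1) l
  rw [YoungDiagram.mem_iff_lt_rowLen]
  simp only [Int.add_one_le_iff] at h2
  unfold rightPart at h1
  omega

theorem starLeft_transpose (μ ν : YoungDiagram) :
    starLeft ν.transpose μ.transpose = (starLeft μ ν).transpose := by
  ext ⟨k, l⟩
  rw [YoungDiagram.mem_cells, YoungDiagram.mem_cells, YoungDiagram.mem_transpose, Prod.swap_prod_mk,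
    mem_starLeft_iff, mem_starLeft_iff, YoungDiagram.rowLen_transpose,
    YoungDiagram.colLen_transpose]
  omega

theorem starRight_transpose (μ ν : YoungDiagram) :
    starRight ν.transpose μ.transpose = (starRight μ ν).transpose := by
  ext ⟨k, l⟩
  rw [YoungDiagram.mem_cells, YoungDiagram.mem_cells, YoungDiagram.mem_transpose, Prod.swap_prod_mk,
    mem_starRight_iff, mem_starRight_iff, YoungDiagram.rowLen_transpose,
    YoungDiagram.colLen_transpose]
  omega

end Conjugation

/-! ### Diagrams described by their row lengths -/

section Diagrams

theorem eq_of_rowLen_eq {μ ν : YoungDiagram} (h : ∀ i, μ.rowLen i = ν.rowLen i) : μ = ν := by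
  ext ⟨i, j⟩
  rw [YoungDiagram.mem_cells, YoungDiagram.mem_cells, YoungDiagram.mem_iff_lt_rowLen,
    YoungDiagram.mem_iff_lt_rowLen, h i]

theorem exists_rowLen_eq {f : ℕ → ℕ} (hf : ∀ i, f (i + 1) ≤ f i) {n : ℕ} (hn : f n = 0) :
    ∃ κ : YoungDiagram, ∀ i, κ.rowLen i = f i := by
  have hanti : Antitone f := antitone_nat_of_succ_le hf
  refine ⟨YoungDiagram.ofRowLens ((List.range n).map f) ?_, fun i => ?_⟩
  · exact List.Pairwise.sortedGE
      (List.pairwise_map.2 (List.pairwise_lt_range.imp fun h => hanti h.le))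
  · rw [rowLen_ofRowLens_map]
    split_ifs with h
    · rfl
    · have := hanti (not_lt.1 h)
      omega

theorem card_eq_sum_rowLen {μ : YoungDiagram} {n : ℕ} (hn : μ.colLen 0 ≤ n) :
    μ.card = ∑ i ∈ Finset.range n, μ.rowLen i := by
  rw [YoungDiagram.card, Finset.card_eq_sum_card_fiberwise (f := Prod.fst) (t := Finset.range n)]
  · refine Finset.sum_congr rfl fun i _ => ?_
    rw [YoungDiagram.rowLen_eq_card, YoungDiagram.row]
  · rintro ⟨i, j⟩ h
    have h1 := YoungDiagram.mem_iff_lt_colLen.1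
      (μ.up_left_mem le_rfl (Nat.zero_le j) ((YoungDiagram.mem_cells _).1 h))
    simp only [Finset.coe_range, Set.mem_Iio]
    omega

theorem card_le_card_of_rowLen_le {μ ν : YoungDiagram} (h : ∀ i, μ.rowLen i ≤ ν.rowLen i) :
    μ.card ≤ ν.card :=
  Finset.card_le_card fun ⟨i, j⟩ hc => by
    rw [YoungDiagram.mem_cells, YoungDiagram.mem_iff_lt_rowLen] at hc ⊢
    exact hc.trans_le (h i)

theorem colLen_zero_le_card (μ : YoungDiagram) : μ.colLen 0 ≤ μ.card := by
  rw [YoungDiagram.colLen_eq_card]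
  exact Finset.card_le_card (Finset.filter_subset _ _)

theorem card_transpose (μ : YoungDiagram) : μ.transpose.card = μ.card := by
  simp [YoungDiagram.card, YoungDiagram.transpose]

theorem finite_card_eq (n : ℕ) : {μ : YoungDiagram | μ.card = n}.Finite := by
  refine Set.Finite.of_finite_image (f := YoungDiagram.cells)
    ((Finset.finite_toSet (Finset.range n ×ˢ Finset.range n).powerset).subset ?_)
    (fun μ _ ν _ h => YoungDiagram.ext h)
  rintro _ ⟨μ, hμ, rfl⟩
  simp only [Finset.coe_powerset, Set.mem_preimage, Set.mem_powerset_iff, Finset.coe_subset]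
  rintro ⟨i, j⟩ h
  rw [YoungDiagram.mem_cells] at h
  have h1 := YoungDiagram.mem_iff_lt_colLen.1 (μ.up_left_mem le_rfl (Nat.zero_le j) h)
  have h2 := YoungDiagram.mem_iff_lt_rowLen.1 (μ.up_left_mem (Nat.zero_le i) le_rfl h)
  have h3 := colLen_zero_le_card μ
  have h4 := colLen_zero_le_card μ.transpose
  rw [YoungDiagram.colLen_transpose, card_transpose] at h4
  rw [Set.mem_ofPred_eq] at hμ
  simp only [Finset.mem_product, Finset.mem_range]
  omega

end Diagrams

/-! ### Horizontal and vertical strips -/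

section Strips

/-- `κ / μ` is a horizontal strip: the rows of `κ` and `μ` interlace. -/
def IsHorizontalStrip (κ μ : YoungDiagram) : Prop :=
  ∀ i, μ.rowLen i ≤ κ.rowLen i ∧ κ.rowLen (i + 1) ≤ μ.rowLen i

open Classical in
/-- The diagrams obtained from `μ` by adding a horizontal strip of size `k`. -/
noncomputable def addStrips (k : ℕ) (μ : YoungDiagram) : Finset YoungDiagram :=
  (finite_card_eq (μ.card + k)).toFinset.filter fun κ => IsHorizontalStrip κ μ

open Classical in
/-- The diagrams obtained from `κ` by removing a horizontal strip of size `k`. -/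
noncomputable def removeStrips (k : ℕ) (κ : YoungDiagram) : Finset YoungDiagram :=
  (finite_card_eq (κ.card - k)).toFinset.filter fun μ =>
    IsHorizontalStrip κ μ ∧ κ.card = μ.card + k

theorem mem_addStrips {k : ℕ} {κ μ : YoungDiagram} :
    κ ∈ addStrips k μ ↔ IsHorizontalStrip κ μ ∧ κ.card = μ.card + k := by
  simp [addStrips, and_comm]

theorem mem_removeStrips {k : ℕ} {κ μ : YoungDiagram} :
    μ ∈ removeStrips k κ ↔ IsHorizontalStrip κ μ ∧ κ.card = μ.card + k := by
  simp only [removeStrips, Finset.mem_filter, Set.Finite.mem_toFinset, Set.mem_ofPred_eq,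
    and_iff_right_iff_imp]
  omega

theorem mem_removeStrips_iff_mem_addStrips {k : ℕ} {κ μ : YoungDiagram} :
    μ ∈ removeStrips k κ ↔ κ ∈ addStrips k μ := by
  rw [mem_removeStrips, mem_addStrips]

/-- A vertical strip has at most one cell in each row. This form lets vertical strips be handled by
arithmetic of row lengths. -/
theorem isHorizontalStrip_transpose_iff {κ μ : YoungDiagram} :
    IsHorizontalStrip κ.transpose μ.transpose ↔
      ∀ i, μ.rowLen i ≤ κ.rowLen i ∧ κ.rowLen i ≤ μ.rowLen i + 1 := by
  simp only [IsHorizontalStrip, YoungDiagram.rowLen_transpose]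
  have hmem : ∀ (θ : YoungDiagram) (i j : ℕ), i < θ.colLen j ↔ j < θ.rowLen i := fun θ i j => by
    rw [← YoungDiagram.mem_iff_lt_colLen, YoungDiagram.mem_iff_lt_rowLen]
  constructor
  · intro h i
    refine ⟨?_, ?_⟩ <;> by_contra! hlt
    · have h1 := (hmem κ i (κ.rowLen i)).1 (((hmem μ _ _).2 hlt).trans_le (h _).1)
      omega
    · have h1 := (hmem μ i (μ.rowLen i)).1 (((hmem κ _ _).2 hlt).trans_le (h _).2)
      omega
  · intro h j
    refine ⟨?_, ?_⟩ <;> by_contra! hlt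
    · have h1 := (hmem κ _ _).2 (((hmem μ _ _).1 hlt).trans_le (h _).1)
      omega
    · have h1 := (hmem μ (μ.colLen j) j).2 (by
        have := (hmem κ _ _).1 hlt
        have := (h (μ.colLen j)).2
        omega)
      omega

end Strips

/-! ### The local rule of growth diagrams -/

section Local

/-- The row condition that matches a diagram `κ` containing `μ` and `ν` with a diagram `κ'` contained
in `μ` and `ν`, where `j` is the excess of the first row of `κ`. -/
def LocalMatch (μ ν : YoungDiagram) (j : ℕ) (κ κ' : YoungDiagram) : Prop :=
  κ.rowLen 0 = max (μ.rowLen 0) (ν.rowLen 0) + j ∧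
    ∀ i, κ.rowLen (i + 1) + κ'.rowLen i =
      min (μ.rowLen i) (ν.rowLen i) + max (μ.rowLen (i + 1)) (ν.rowLen (i + 1))

/-- Summing the row equations, the maxima over rows `i + 1` together with row `0` give the sum of
all maxima, and `min + max` is the sum of the two rows. -/
theorem LocalMatch.card_add_card {μ ν κ κ' : YoungDiagram} {j : ℕ} (h : LocalMatch μ ν j κ κ') :
    κ.card + κ'.card = μ.card + ν.card + j := by
  set N := μ.colLen 0 + ν.colLen 0 + κ.colLen 0 + κ'.colLen 0 with hN
  rw [card_eq_sum_rowLen (μ := κ) (n := N + 1) (by omega),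
    card_eq_sum_rowLen (μ := κ') (n := N) (by omega),
    card_eq_sum_rowLen (μ := μ) (n := N) (by omega),
    card_eq_sum_rowLen (μ := ν) (n := N) (by omega), Finset.sum_range_succ', add_right_comm,
    ← Finset.sum_add_distrib, ← Finset.sum_add_distrib, Finset.sum_congr rfl fun i _ => h.2 i,
    Finset.sum_add_distrib, h.1]
  have h1 := Finset.sum_range_succ' (fun i => max (μ.rowLen i) (ν.rowLen i)) N
  rw [Finset.sum_range_succ, rowLen_eq_zero (μ := μ) (i := N) (by omega),
    rowLen_eq_zero (μ := ν) (i := N) (by omega)] at h1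
  have h2 : ∑ i ∈ Finset.range N, (μ.rowLen i + ν.rowLen i) =
      ∑ i ∈ Finset.range N, min (μ.rowLen i) (ν.rowLen i) +
        ∑ i ∈ Finset.range N, max (μ.rowLen i) (ν.rowLen i) := by
    rw [← Finset.sum_add_distrib]
    exact Finset.sum_congr rfl fun i _ => (min_add_max _ _).symm
  omega

/-- Both strip conditions confine a row to the interval from `max (μ_{i+1}, ν_{i+1})` to `min (μ_i,
ν_i)`: row `i + 1` of `κ` on one side, row `i` of `κ'` on the other. The match is reflection in this
interval. Row `0` of `κ` is bounded only from below, which leaves the parameter `j`. -/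
theorem LocalMatch.isHorizontalStrip_iff {μ ν κ κ' : YoungDiagram} {j : ℕ}
    (h : LocalMatch μ ν j κ κ') :
    (IsHorizontalStrip κ μ ∧ IsHorizontalStrip κ ν) ↔
      (IsHorizontalStrip μ κ' ∧ IsHorizontalStrip ν κ') := by
  constructor
  · rintro ⟨h1, h2⟩
    constructor <;> intro i <;>
      have := h.2 i <;> have := h1 i <;> have := h2 i <;> have := h1 (i + 1) <;>
      have := h2 (i + 1) <;> omega
  · rintro ⟨h1, h2⟩
    constructor <;> rintro (_ | i) <;> have := h.1 <;> have := h.2 0 <;> have := h1 0 <;>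
      have := h2 0
    · omega
    · have := h.2 i
      have := h.2 (i + 1)
      have := h1 i
      have := h2 i
      have := h1 (i + 1)
      have := h2 (i + 1)
      omega
    · omega
    · have := h.2 i
      have := h.2 (i + 1)
      have := h1 i
      have := h2 i
      have := h1 (i + 1)
      have := h2 (i + 1)
      omega

theorem exists_localMatch_of_above {μ ν κ : YoungDiagram} (h1 : IsHorizontalStrip κ μ)
    (h2 : IsHorizontalStrip κ ν) : ∃ j κ', LocalMatch μ ν j κ κ' := by
  obtain ⟨κ', h'⟩ := exists_rowLen_eq
    (f := fun i => min (μ.rowLen i) (ν.rowLen i) + max (μ.rowLen (i + 1)) (ν.rowLen (i + 1)) -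
      κ.rowLen (i + 1)) (n := μ.colLen 0 + ν.colLen 0)
    (fun i => by
      have := h1 i
      have := h2 i
      have := h1 (i + 1)
      have := h2 (i + 1)
      have := h1 (i + 1 + 1)
      have := h2 (i + 1 + 1)
      omega)
    (by
      have h3 := rowLen_eq_zero (μ := μ) (i := μ.colLen 0 + ν.colLen 0) (by omega)
      have h4 := rowLen_eq_zero (μ := ν) (i := μ.colLen 0 + ν.colLen 0) (by omega)
      have h5 := μ.rowLen_anti _ _ (Nat.le_succ (μ.colLen 0 + ν.colLen 0))
      have h6 := ν.rowLen_anti _ _ (Nat.le_succ (μ.colLen 0 + ν.colLen 0))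
      simp only [Nat.succ_eq_add_one] at h5 h6
      omega)
  refine ⟨κ.rowLen 0 - max (μ.rowLen 0) (ν.rowLen 0), κ', ?_, fun i => ?_⟩
  · have := h1 0
    have := h2 0
    omega
  · have := h' i
    have := h1 i
    have := h2 i
    have := h1 (i + 1)
    have := h2 (i + 1)
    omega

theorem exists_localMatch_of_below {μ ν κ' : YoungDiagram} (j : ℕ) (h1 : IsHorizontalStrip μ κ')
    (h2 : IsHorizontalStrip ν κ') : ∃ κ, LocalMatch μ ν j κ κ' := by
  obtain ⟨κ, h'⟩ := exists_rowLen_eq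
    (f := fun i => match i with
      | 0 => max (μ.rowLen 0) (ν.rowLen 0) + j
      | i + 1 =>
        min (μ.rowLen i) (ν.rowLen i) + max (μ.rowLen (i + 1)) (ν.rowLen (i + 1)) - κ'.rowLen i)
    (n := μ.colLen 0 + ν.colLen 0 + 1)
    (fun i => by
      have := h1 i
      have := h2 i
      rcases i with _ | i
      · dsimp only
        omega
      · have := h1 i
        have := h2 i
        dsimp only
        omega)
    (by
      have h3 := rowLen_eq_zero (μ := μ) (i := μ.colLen 0 + ν.colLen 0) (by omega)
      have h4 := rowLen_eq_zero (μ := ν) (i := μ.colLen 0 + ν.colLen 0) (by omega)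
      have h5 := μ.rowLen_anti _ _ (Nat.le_succ (μ.colLen 0 + ν.colLen 0))
      have h6 := ν.rowLen_anti _ _ (Nat.le_succ (μ.colLen 0 + ν.colLen 0))
      simp only [Nat.succ_eq_add_one] at h5 h6 ⊢
      omega)
  refine ⟨κ, h' 0, fun i => ?_⟩
  have h3 := h' (i + 1)
  dsimp only at h3
  have := h1 i
  have := h2 i
  omega

theorem LocalMatch.eq_above {μ ν κ₁ κ₂ κ' : YoungDiagram} {j : ℕ} (h1 : LocalMatch μ ν j κ₁ κ')
    (h2 : LocalMatch μ ν j κ₂ κ') : κ₁ = κ₂ := by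
  refine eq_of_rowLen_eq fun i => ?_
  rcases i with _ | i
  · rw [h1.1, h2.1]
  · have := h1.2 i
    have := h2.2 i
    omega

theorem LocalMatch.eq_below {μ ν κ κ₁ κ₂ : YoungDiagram} {j₁ j₂ : ℕ} (h1 : LocalMatch μ ν j₁ κ κ₁)
    (h2 : LocalMatch μ ν j₂ κ κ₂) : j₁ = j₂ ∧ κ₁ = κ₂ := by
  refine ⟨?_, eq_of_rowLen_eq fun i => ?_⟩
  · have := h1.1
    have := h2.1
    omega
  · have := h1.2 i
    have := h2.2 i
    omega

open Classical in
/-- The local rule of growth diagrams, in counting form. -/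
theorem card_above_eq_sum_card_below (k m : ℕ) (μ ν : YoungDiagram) :
    ((addStrips k μ).filter fun κ => ν ∈ removeStrips m κ).card =
      ∑ j ∈ Finset.range (min m k + 1),
        ((removeStrips (m - j) μ).filter fun κ' => ν ∈ addStrips (k - j) κ').card := by
  rw [← Finset.card_sigma]
  have hA : ∀ κ, κ ∈ (addStrips k μ).filter (fun κ => ν ∈ removeStrips m κ) →
      ∃ x : (_ : ℕ) × YoungDiagram, LocalMatch μ ν x.1 κ x.2 := fun κ hκ => by
    simp only [Finset.mem_filter, mem_addStrips, mem_removeStrips] at hκ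
    obtain ⟨j, κ', h⟩ := exists_localMatch_of_above hκ.1.1 hκ.2.1
    exact ⟨⟨j, κ'⟩, h⟩
  choose! f hf using hA
  refine Finset.card_bij (fun κ _ => f κ) (fun κ hκ => ?_) (fun κ₁ h₁ κ₂ h₂ h => ?_) ?_
  · have h1 := hf κ hκ
    have h2 := h1.card_add_card
    simp only [Finset.mem_filter, mem_addStrips, mem_removeStrips] at hκ
    have h3 := h1.isHorizontalStrip_iff.1 ⟨hκ.1.1, hκ.2.1⟩
    -- Containment of `κ'` in `μ` and in `ν` gives `j ≤ m` and `j ≤ k` by comparing sizes.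
    have h4 := card_le_card_of_rowLen_le fun i => (h3.1 i).1
    have h5 := card_le_card_of_rowLen_le fun i => (h3.2 i).1
    simp only [Finset.mem_sigma, Finset.mem_range, Finset.mem_filter, mem_addStrips,
      mem_removeStrips]
    exact ⟨by omega, ⟨h3.1, by omega⟩, h3.2, by omega⟩
  · have h3 := hf κ₁ h₁
    rw [h] at h3
    exact h3.eq_above (hf κ₂ h₂)
  · rintro ⟨j, κ'⟩ hx
    simp only [Finset.mem_sigma, Finset.mem_range, Finset.mem_filter, mem_addStrips,
      mem_removeStrips] at hx
    obtain ⟨hj, ⟨h1, h2⟩, h3, h4⟩ := hx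
    obtain ⟨κ, hκ⟩ := exists_localMatch_of_below j h1 h3
    have h5 := hκ.card_add_card
    have h6 := hκ.isHorizontalStrip_iff.2 ⟨h1, h3⟩
    have hmem : κ ∈ (addStrips k μ).filter (fun κ => ν ∈ removeStrips m κ) := by
      simp only [Finset.mem_filter, mem_addStrips, mem_removeStrips]
      exact ⟨⟨h6.1, by omega⟩, h6.2, by omega⟩
    refine ⟨κ, hmem, ?_⟩
    obtain ⟨h7, h8⟩ := (hf κ hmem).eq_below hκ
    exact Sigma.ext h7 (heq_of_eq h8)

end Local

/-! ### Strip operators: commutation, adjointness, generation -/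

section Operators

/-- The operator `μ ↦ ∑ κ`, the sum over all `κ` obtained from `μ` by adding a horizontal strip of
size `k`. -/
noncomputable def addOp (k : ℕ) : (YoungDiagram →₀ ℤ) →ₗ[ℤ] (YoungDiagram →₀ ℤ) :=
  Finsupp.linearCombination ℤ fun μ => ∑ κ ∈ addStrips k μ, Finsupp.single κ 1

/-- The operator `κ ↦ ∑ μ`, the sum over all `μ` obtained from `κ` by removing a horizontal strip of
size `k`. -/
noncomputable def removeOp (k : ℕ) : (YoungDiagram →₀ ℤ) →ₗ[ℤ] (YoungDiagram →₀ ℤ) :=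
  Finsupp.linearCombination ℤ fun κ => ∑ μ ∈ removeStrips k κ, Finsupp.single μ 1

/-- The linear extension of the conjugation of diagrams. -/
noncomputable def conj : (YoungDiagram →₀ ℤ) →ₗ[ℤ] (YoungDiagram →₀ ℤ) :=
  Finsupp.lmapDomain ℤ ℤ YoungDiagram.transpose

@[simp]
theorem addOp_single (k : ℕ) (μ : YoungDiagram) :
    addOp k (Finsupp.single μ 1) = ∑ κ ∈ addStrips k μ, Finsupp.single κ 1 := by
  simp [addOp]

@[simp]
theorem removeOp_single (k : ℕ) (κ : YoungDiagram) :
    removeOp k (Finsupp.single κ 1) = ∑ μ ∈ removeStrips k κ, Finsupp.single μ 1 := by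
  simp [removeOp]

@[simp]
theorem conj_single (μ : YoungDiagram) (n : ℤ) :
    conj (Finsupp.single μ n) = Finsupp.single μ.transpose n := by
  simp [conj]

@[simp]
theorem conj_conj (a : YoungDiagram →₀ ℤ) : conj (conj a) = a := by
  induction a using Finsupp.induction_linear with
  | zero => simp
  | add f g hf hg => rw [map_add, map_add, hf, hg]
  | single μ n => simp

theorem linearMap_ext {M : Type*} [AddCommGroup M] {f g : (YoungDiagram →₀ ℤ) →ₗ[ℤ] M}
    (h : ∀ μ, f (Finsupp.single μ 1) = g (Finsupp.single μ 1)) (a : YoungDiagram →₀ ℤ) :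
    f a = g a := by
  have : f = g := Finsupp.lhom_ext' fun μ => LinearMap.ext_ring (h μ)
  rw [this]

theorem sum_single_apply (s : Finset YoungDiagram) (ν : YoungDiagram) [Decidable (ν ∈ s)] :
    (∑ κ ∈ s, Finsupp.single κ (1 : ℤ)) ν = if ν ∈ s then 1 else 0 := by
  classical
  simp [Finsupp.finsetSum_apply, Finsupp.single_apply]

theorem addOp_single_apply (k : ℕ) (μ ν : YoungDiagram) [Decidable (ν ∈ addStrips k μ)] :
    addOp k (Finsupp.single μ 1) ν = if ν ∈ addStrips k μ then 1 else 0 := by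
  rw [addOp_single, sum_single_apply]

theorem removeOp_single_apply (k : ℕ) (μ ν : YoungDiagram) [Decidable (ν ∈ removeStrips k μ)] :
    removeOp k (Finsupp.single μ 1) ν = if ν ∈ removeStrips k μ then 1 else 0 := by
  rw [removeOp_single, sum_single_apply]

/-- The matrix entries of the two sides count the diagrams above and below a pair, so this is the
local rule in operator form. -/
theorem removeOp_addOp (m k : ℕ) (b : YoungDiagram →₀ ℤ) :
    removeOp m (addOp k b) =
      ∑ j ∈ Finset.range (min m k + 1), addOp (k - j) (removeOp (m - j) b) := by
  classical
  have h := linearMap_ext (f := removeOp m ∘ₗ addOp k)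
    (g := ∑ j ∈ Finset.range (min m k + 1), addOp (k - j) ∘ₗ removeOp (m - j)) (fun μ => ?_) b
  · simpa using h
  ext ν
  rw [LinearMap.comp_apply, addOp_single, map_sum, Finsupp.finsetSum_apply, LinearMap.sum_apply,
    Finsupp.finsetSum_apply]
  simp only [removeOp_single_apply]
  rw [Finset.sum_boole, card_above_eq_sum_card_below, Nat.cast_sum]
  refine Finset.sum_congr rfl fun j _ => ?_
  rw [LinearMap.comp_apply, removeOp_single, map_sum, Finsupp.finsetSum_apply]
  simp only [addOp_single_apply]
  rw [Finset.sum_boole]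

/-- The operators that add and remove horizontal strips are adjoint to each other. -/
theorem linearCombination_addOp (k : ℕ) (a b : YoungDiagram →₀ ℤ) :
    Finsupp.linearCombination ℤ b (addOp k a) =
      Finsupp.linearCombination ℤ (removeOp k b) a := by
  classical
  refine linearMap_ext (f := Finsupp.linearCombination ℤ b ∘ₗ addOp k)
    (g := Finsupp.linearCombination ℤ (removeOp k b)) (fun μ => ?_) a
  have h := linearMap_ext (f := ∑ κ ∈ addStrips k μ, Finsupp.lapply κ)
    (g := Finsupp.lapply μ ∘ₗ removeOp k) (fun ν => ?_) b
  · simpa using h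
  simp only [LinearMap.sum_apply, Finsupp.lapply_apply, LinearMap.comp_apply, removeOp_single_apply,
    mem_removeStrips_iff_mem_addStrips]
  simp [Finsupp.single_apply]

/-- Unitriangularity: adding strips of size `m` to `lam` without its last row, of length `m`, yields
`lam` plus diagrams with a shorter row in that place. Induction runs on the number of rows, then on
the length of the last one. -/
theorem eq_top_of_addOp_mem {W : Submodule ℤ (YoungDiagram →₀ ℤ)} (h0 : Finsupp.single ⊥ 1 ∈ W)
    (hW : ∀ k, ∀ a ∈ W, addOp k a ∈ W) : W = ⊤ := by
  classical
  have key : ∀ (r : ℕ) (lam : YoungDiagram), lam.rowLen r = 0 → Finsupp.single lam (1 : ℤ) ∈ W := by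
    intro r
    induction r with
    | zero =>
      intro lam h
      have : lam = ⊥ := by
        ext ⟨i, j⟩
        have := lam.rowLen_anti 0 i (Nat.zero_le i)
        rw [YoungDiagram.mem_cells, YoungDiagram.mem_iff_lt_rowLen, YoungDiagram.cells_bot]
        simp only [Finset.notMem_empty, iff_false]
        omega
      rwa [this]
    | succ r ih =>
      intro lam hlam
      induction hm : lam.rowLen r using Nat.strong_induction_on generalizing lam with
      | _ m ihm =>
        obtain ⟨μ, hμ⟩ := exists_rowLen_eq (f := fun i => if i < r then lam.rowLen i else 0) (n := r)
          (fun i => by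
            have := lam.rowLen_anti i (i + 1) (Nat.le_succ i)
            split_ifs <;> omega) (by simp)
        have hsum : ∀ κ : YoungDiagram, κ.rowLen (r + 1) = 0 →
            κ.card = ∑ i ∈ Finset.range r, κ.rowLen i + κ.rowLen r := fun κ hκ => by
          rw [← Finset.sum_range_succ]
          refine card_eq_sum_rowLen ?_
          by_contra! hlt
          have := YoungDiagram.mem_iff_lt_rowLen.1 (YoungDiagram.mem_iff_lt_colLen.2 hlt)
          omega
        have hμr : μ.rowLen r = 0 := by rw [hμ]; simp
        have hμr' : μ.rowLen (r + 1) = 0 := by rw [hμ]; simp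
        have hμ' : ∑ i ∈ Finset.range r, μ.rowLen i = ∑ i ∈ Finset.range r, lam.rowLen i :=
          Finset.sum_congr rfl fun i hi => by rw [hμ, if_pos (Finset.mem_range.1 hi)]
        have hc1 := hsum μ hμr'
        have hc2 := hsum lam hlam
        have hmem : lam ∈ addStrips m μ := by
          refine mem_addStrips.2 ⟨fun i => ?_, by omega⟩
          rw [hμ]
          split_ifs with h
          · exact ⟨le_rfl, lam.rowLen_anti _ _ (Nat.le_succ i)⟩
          · refine ⟨Nat.zero_le _, ?_⟩
            have := lam.rowLen_anti (r + 1) (i + 1) (by omega)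
            omega
        have h1 := hW m _ (ih μ hμr)
        rw [addOp_single, ← Finset.add_sum_erase _ _ hmem] at h1
        refine (Submodule.add_mem_iff_left W (Submodule.sum_mem W fun κ hκ => ?_)).1 h1
        obtain ⟨hne, hκ⟩ := Finset.mem_erase.1 hκ
        obtain ⟨hs, hcard⟩ := mem_addStrips.1 hκ
        have hκr : κ.rowLen (r + 1) = 0 := by
          have := (hs r).2
          omega
        have hc3 := hsum κ hκr
        have hle : ∀ i ∈ Finset.range r, lam.rowLen i ≤ κ.rowLen i := fun i hi => by
          have := (hs i).1
          rwa [hμ, if_pos (Finset.mem_range.1 hi)] at this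
        have hsle := Finset.sum_le_sum hle
        refine ihm (κ.rowLen r) ?_ κ hκr rfl
        -- The rows of `κ` above `r` are at least those of `lam` and the sizes agree, so a row `r`
        -- that is no shorter would force `κ = lam`.
        by_contra! hlt
        refine hne (eq_of_rowLen_eq fun i => ?_)
        rcases lt_trichotomy i r with h | h | h
        · exact ((Finset.sum_eq_sum_iff_of_le hle).1 (by omega) i (Finset.mem_range.2 h)).symm
        · subst h
          omega
        · have := κ.rowLen_anti (r + 1) i h
          have := lam.rowLen_anti (r + 1) i h
          omega
  rw [eq_top_iff]
  rintro a -
  induction a using Finsupp.induction_linear with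
  | zero => exact W.zero_mem
  | add f g hf hg => exact W.add_mem hf hg
  | single μ n =>
    have := W.smul_mem n (key _ μ (rowLen_eq_zero le_rfl))
    simpa using this

end Operators

/-! ### Sign-reversing involution for horizontal and vertical strips -/

section Alternating

theorem card_add_rowLen_eq_of_forall_ne {κ κ' : YoungDiagram} {r : ℕ}
    (h : ∀ i, i ≠ r → κ.rowLen i = κ'.rowLen i) :
    κ.card + κ'.rowLen r = κ'.card + κ.rowLen r := by
  have hr : r ∈ Finset.range (κ.colLen 0 + κ'.colLen 0 + r + 1) := Finset.mem_range.2 (by omega)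
  rw [card_eq_sum_rowLen (μ := κ) (n := κ.colLen 0 + κ'.colLen 0 + r + 1) (by omega),
    card_eq_sum_rowLen (μ := κ') (n := κ.colLen 0 + κ'.colLen 0 + r + 1) (by omega),
    ← Finset.sum_erase_add _ _ hr, ← Finset.sum_erase_add _ _ hr,
    Finset.sum_congr rfl fun i hi => h i (Finset.ne_of_mem_erase hi)]
  exact add_right_comm _ _ _

/-- If `κ / μ` is a horizontal strip and `lam / κ` a vertical one, then the first row in which `μ` and
`lam` differ can be toggled in `κ`. -/
theorem exists_toggle {μ lam : YoungDiagram} {r : ℕ} (hr : μ.rowLen r ≠ lam.rowLen r)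
    (hlt : ∀ i < r, μ.rowLen i = lam.rowLen i) {κ : YoungDiagram} (h1 : IsHorizontalStrip κ μ)
    (h2 : IsHorizontalStrip lam.transpose κ.transpose) :
    ∃ κ' : YoungDiagram, IsHorizontalStrip κ' μ ∧ IsHorizontalStrip lam.transpose κ'.transpose ∧
      (∀ i, i ≠ r → κ.rowLen i = κ'.rowLen i) ∧ κ.rowLen r + κ'.rowLen r + 1 = 2 * lam.rowLen r := by
  rw [isHorizontalStrip_transpose_iff] at h2
  have hfr := h1 r
  have hgr := h2 r
  have hprev : ∀ i, i + 1 = r → lam.rowLen r ≤ μ.rowLen i := fun i hi => by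
    rw [hlt i (by omega)]
    exact lam.rowLen_anti _ _ (by omega)
  -- The vertical strip leaves only `lam_r` and `lam_r - 1` for row `r` of `κ`, and `2 * lam_r - 1 -
  -- κ_r` swaps them. Both are admissible: `μ_r < lam_r`, and the row above satisfies `μ_{r-1} =
  -- lam_{r-1} ≥ lam_r`.
  obtain ⟨κ', h'⟩ := exists_rowLen_eq
    (f := fun i => if i = r then 2 * lam.rowLen r - 1 - κ.rowLen r else κ.rowLen i)
    (n := κ.colLen 0 + r + 1)
    (fun i => by
      have := h1 i
      have := hprev i
      have := κ.rowLen_anti i (i + 1) (Nat.le_succ i)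
      split_ifs with h3 h4 h4
      · omega
      · omega
      · subst h4
        omega
      · omega)
    (by rw [if_neg (by omega), rowLen_eq_zero (by omega)])
  refine ⟨κ', fun i => ?_, ?_, fun i hi => by rw [h', if_neg hi], ?_⟩
  · have := h1 i
    have := hprev i
    rw [h', h']
    split_ifs with h3 h4 h4
    · omega
    · subst h3
      omega
    · omega
    · omega
  · rw [isHorizontalStrip_transpose_iff]
    intro i
    have := h2 i
    rw [h']
    split_ifs with h3
    · subst h3
      omega
    · omega
  · rw [h', if_pos rfl]
    omega

open Classical in
-- Toggling the first row in which `μ` and `lam` differ changes the size of the intermediate diagram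
-- by one, hence flips the sign. If `μ = lam`, the positivity of `k` leaves nothing to sum.
theorem alternating_sum_strips_eq_zero {k : ℕ} (hk : 0 < k) (μ lam : YoungDiagram) :
    ∑ x ∈ ((Finset.range (k + 1)).sigma fun i => addStrips i μ).filter fun x =>
      lam.transpose ∈ addStrips (k - x.1) x.2.transpose, (-1 : ℤ) ^ x.1 = 0 := by
  have hmem : ∀ x : (_ : ℕ) × YoungDiagram,
      x ∈ ((Finset.range (k + 1)).sigma fun i => addStrips i μ).filter (fun x =>
        lam.transpose ∈ addStrips (k - x.1) x.2.transpose) ↔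
      (IsHorizontalStrip x.2 μ ∧ IsHorizontalStrip lam.transpose x.2.transpose) ∧
        x.2.card = μ.card + x.1 ∧ lam.card = μ.card + k := fun x => by
    simp only [Finset.mem_filter, Finset.mem_sigma, Finset.mem_range, mem_addStrips, card_transpose]
    constructor
    · rintro ⟨⟨h1, h2, h3⟩, h4, h5⟩
      exact ⟨⟨h2, h4⟩, h3, by omega⟩
    · rintro ⟨⟨h1, h2⟩, h3, h4⟩
      have := card_le_card_of_rowLen_le fun i => (isHorizontalStrip_transpose_iff.1 h2 i).1
      exact ⟨⟨by omega, h1, h3⟩, h2, by omega⟩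
  by_cases hne : μ = lam
  · refine Finset.sum_eq_zero fun x hx => ?_
    have := (hmem x).1 hx
    subst hne
    omega
  have hex : ∃ i, μ.rowLen i ≠ lam.rowLen i := by
    by_contra! h
    exact hne (eq_of_rowLen_eq h)
  have htoggle := fun κ => exists_toggle (κ := κ) (Nat.find_spec hex)
    fun i hi => not_not.1 (Nat.find_min hex hi)
  set r := Nat.find hex
  choose! t ht using fun κ (h : IsHorizontalStrip κ μ ∧
    IsHorizontalStrip lam.transpose κ.transpose) => htoggle κ h.1 h.2
  have hcard : ∀ κ, IsHorizontalStrip κ μ ∧ IsHorizontalStrip lam.transpose κ.transpose →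
      μ.card ≤ (t κ).card ∧ ((t κ).card = κ.card + 1 ∨ κ.card = (t κ).card + 1) := fun κ hκ => by
    obtain ⟨h1, h2, h3, h4⟩ := ht κ hκ
    have h5 := card_add_rowLen_eq_of_forall_ne h3
    have h6 := isHorizontalStrip_transpose_iff.1 hκ.2 r
    have h7 := card_le_card_of_rowLen_le fun i => (h1 i).1
    omega
  refine Finset.sum_involution (fun x _ => ⟨(t x.2).card - μ.card, t x.2⟩) (fun x hx => ?_)
    (fun x hx _ h => ?_) (fun x hx => ?_) fun x hx => ?_
  · obtain ⟨hx, h1, -⟩ := (hmem x).1 hx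
    obtain ⟨h2, h3⟩ := hcard _ hx
    rcases h3 with h3 | h3
    · rw [show (t x.2).card - μ.card = x.1 + 1 by omega, pow_succ]
      ring
    · rw [show x.1 = (t x.2).card - μ.card + 1 by omega, pow_succ]
      ring
  · obtain ⟨hx, h1, -⟩ := (hmem x).1 hx
    obtain ⟨h2, h3⟩ := hcard _ hx
    have h4 : (t x.2).card - μ.card = x.1 := congrArg Sigma.fst h
    omega
  · obtain ⟨hx, h1, h5⟩ := (hmem x).1 hx
    obtain ⟨h2, h3⟩ := hcard _ hx
    obtain ⟨h6, h7, -⟩ := ht _ hx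
    exact (hmem _).2 ⟨⟨h6, h7⟩, by dsimp only; omega, h5⟩
  · obtain ⟨hx, h1, -⟩ := (hmem x).1 hx
    obtain ⟨h2, h3, h4, h5⟩ := ht _ hx
    obtain ⟨h6, h7, h8, h9⟩ := ht _ ⟨h2, h3⟩
    have h10 : t (t x.2) = x.2 := eq_of_rowLen_eq fun i => by
      by_cases hi : i = r
      · subst hi
        omega
      · rw [← h8 i hi, ← h4 i hi]
    obtain ⟨i, κ⟩ := x
    dsimp only at h10 h1 ⊢
    rw [h10, h1, Nat.add_sub_cancel_left]

theorem conj_apply (a : YoungDiagram →₀ ℤ) (μ : YoungDiagram) : conj a μ = a μ.transpose := by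
  classical
  refine linearMap_ext (f := Finsupp.lapply μ ∘ₗ conj) (g := Finsupp.lapply μ.transpose)
    (fun ν => ?_) a
  simp [Finsupp.single_apply, YoungDiagram.transpose_eq_iff_eq_transpose]

/-- The operators that add vertical strips and those that add horizontal strips, with alternating
signs, are inverse to each other as generating functions. -/
theorem alternating_sum_conj_addOp {k : ℕ} (hk : 0 < k) (b : YoungDiagram →₀ ℤ) :
    ∑ i ∈ Finset.range (k + 1), (-1 : ℤ) ^ i • conj (addOp (k - i) (conj (addOp i b))) = 0 := by
  classical
  have h := linearMap_ext (f := ∑ i ∈ Finset.range (k + 1),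
    (-1 : ℤ) ^ i • (conj ∘ₗ addOp (k - i) ∘ₗ conj ∘ₗ addOp i)) (g := 0) (fun μ => ?_) b
  · simpa only [LinearMap.sum_apply, LinearMap.smul_apply, LinearMap.comp_apply,
      LinearMap.zero_apply] using h
  ext lam
  rw [LinearMap.zero_apply, Finsupp.zero_apply, ← alternating_sum_strips_eq_zero hk μ lam,
    Finset.sum_filter, Finset.sum_sigma, LinearMap.sum_apply, Finsupp.finsetSum_apply]
  refine Finset.sum_congr rfl fun i _ => ?_
  rw [LinearMap.smul_apply, Finsupp.smul_apply, LinearMap.comp_apply, LinearMap.comp_apply,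
    LinearMap.comp_apply, addOp_single, map_sum, map_sum, conj_apply, Finsupp.finsetSum_apply,
    smul_eq_mul, Finset.mul_sum]
  refine Finset.sum_congr rfl fun κ _ => ?_
  rw [conj_single, addOp_single_apply, mul_ite, mul_one, mul_zero]

end Alternating

/-! ### Branching of semistandard tableaux along the largest entry -/

section Branching

theorem content_apply {μ : YoungDiagram} (T : SemistandardYoungTableau μ) (x : ℕ) :
    content T x = (μ.cells.filter fun c => T c.1 c.2 = x).card := by
  simp [content, Finsupp.finsetSum_apply, Finsupp.single_apply]

theorem degree_content {μ : YoungDiagram} (T : SemistandardYoungTableau μ) :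
    (content T).degree = μ.card := by
  simp [content, YoungDiagram.card]

theorem entry_mem_support_content {μ : YoungDiagram} (T : SemistandardYoungTableau μ) {i j : ℕ}
    (h : (i, j) ∈ μ) : T i j ∈ (content T).support := by
  rw [Finsupp.mem_support_iff, content_apply]
  exact Finset.card_ne_zero_of_mem
    (Finset.mem_filter.2 ⟨(YoungDiagram.mem_cells (i, j)).2 h, rfl⟩)

open Classical in
/-- The tableau of shape `κ` that agrees with `T` on `μ` and has the entry `n` on `κ / μ`. -/
noncomputable def extendTableau {κ μ : YoungDiagram} (h : IsHorizontalStrip κ μ) (n : ℕ)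
    (T : SemistandardYoungTableau μ) (hT : ∀ x ∈ (content T).support, x < n) :
    SemistandardYoungTableau κ where
  entry i j := if (i, j) ∈ μ then T i j else if (i, j) ∈ κ then n else 0
  row_weak' {i j1 j2} hj hc := by
    have hc1 := κ.up_left_mem le_rfl hj.le hc
    rw [if_pos hc, if_pos hc1]
    by_cases h2 : (i, j2) ∈ μ
    · rw [if_pos h2, if_pos (μ.up_left_mem le_rfl hj.le h2)]
      exact T.row_weak hj h2
    · rw [if_neg h2]
      split_ifs with h1
      · exact (hT _ (entry_mem_support_content T h1)).le
      · exact le_rfl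
  col_strict' {i1 i2 j} hi hc := by
    have hc1 : (i1, j) ∈ μ := by
      have h1 := YoungDiagram.mem_iff_lt_rowLen.1 (κ.up_left_mem (Nat.succ_le_of_lt hi) le_rfl hc)
      exact YoungDiagram.mem_iff_lt_rowLen.2 (h1.trans_le (h i1).2)
    rw [if_pos hc, if_pos hc1]
    split_ifs with h2
    · exact T.col_strict hi h2
    · exact hT _ (entry_mem_support_content T hc1)
  zeros' {i j} hc := by
    have : (i, j) ∉ μ := fun h1 => hc
      (YoungDiagram.mem_iff_lt_rowLen.2 ((YoungDiagram.mem_iff_lt_rowLen.1 h1).trans_le (h i).1))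
    rw [if_neg this, if_neg hc]

/-- The restriction of a tableau to its entries smaller than `n`. -/
def restrictShape {κ : YoungDiagram} (T : SemistandardYoungTableau κ) (n : ℕ) : YoungDiagram where
  cells := κ.cells.filter fun c => T c.1 c.2 < n
  isLowerSet := by
    rintro ⟨i2, j2⟩ ⟨i1, j1⟩ hle hc
    obtain ⟨hi, hj⟩ := Prod.mk_le_mk.1 hle
    rw [Finset.mem_coe, Finset.mem_filter, YoungDiagram.mem_cells] at hc ⊢
    exact ⟨κ.up_left_mem hi hj hc.1, ((T.col_weak hi (κ.up_left_mem le_rfl hj hc.1)).trans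
      (T.row_weak_of_le hj hc.1)).trans_lt hc.2⟩

theorem mem_restrictShape {κ : YoungDiagram} {T : SemistandardYoungTableau κ} {n i j : ℕ} :
    (i, j) ∈ restrictShape T n ↔ (i, j) ∈ κ ∧ T i j < n := by
  rw [← YoungDiagram.mem_cells, restrictShape, Finset.mem_filter, YoungDiagram.mem_cells]

/-- The restriction of a tableau to its entries smaller than `n`. -/
def restrictTableau {κ : YoungDiagram} (T : SemistandardYoungTableau κ) (n : ℕ) :
    SemistandardYoungTableau (restrictShape T n) where
  entry i j := if (i, j) ∈ restrictShape T n then T i j else 0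
  row_weak' {i j1 j2} hj hc := by
    rw [if_pos hc, if_pos (YoungDiagram.up_left_mem _ le_rfl hj.le hc)]
    exact T.row_weak hj (mem_restrictShape.1 hc).1
  col_strict' {i1 i2 j} hi hc := by
    rw [if_pos hc, if_pos (YoungDiagram.up_left_mem _ hi.le le_rfl hc)]
    exact T.col_strict hi (mem_restrictShape.1 hc).1
  zeros' {i j} hc := if_neg hc

theorem extendTableau_apply {κ μ : YoungDiagram} (h : IsHorizontalStrip κ μ) (n : ℕ)
    (T : SemistandardYoungTableau μ) (hT : ∀ x ∈ (content T).support, x < n) (i j : ℕ) :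
    extendTableau h n T hT i j = if (i, j) ∈ μ then T i j else if (i, j) ∈ κ then n else 0 := by
  classical
  change ite _ _ _ = _
  congr

theorem restrictTableau_apply {κ : YoungDiagram} (T : SemistandardYoungTableau κ) (n i j : ℕ) :
    restrictTableau T n i j = if (i, j) ∈ restrictShape T n then T i j else 0 := rfl

/-- By column strictness the cell above any cell of `κ` has an entry smaller than `n`, hence
survives the restriction. -/
theorem isHorizontalStrip_restrictShape {κ : YoungDiagram} (T : SemistandardYoungTableau κ) {n : ℕ}
    (hT : ∀ x ∈ (content T).support, x ≤ n) : IsHorizontalStrip κ (restrictShape T n) := by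
  intro i
  refine ⟨?_, ?_⟩ <;> by_contra! hlt <;> rw [← YoungDiagram.mem_iff_lt_rowLen] at hlt
  · have := YoungDiagram.mem_iff_lt_rowLen.1 (mem_restrictShape.1 hlt).1
    omega
  · have h1 := T.col_strict (Nat.lt_succ_self i) hlt
    have h2 := hT _ (entry_mem_support_content T hlt)
    have h3 := YoungDiagram.mem_iff_lt_rowLen.1
      (mem_restrictShape.2 ⟨κ.up_left_mem (Nat.le_succ i) le_rfl hlt, h1.trans_le h2⟩)
    omega

theorem subset_of_isHorizontalStrip {κ μ : YoungDiagram} (h : IsHorizontalStrip κ μ) :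
    μ.cells ⊆ κ.cells := fun ⟨i, j⟩ hc => by
  rw [YoungDiagram.mem_cells, YoungDiagram.mem_iff_lt_rowLen] at hc ⊢
  exact hc.trans_le (h i).1

/-- Lets the multiplicity of `n` be read off from the size of the shape, without counting the cells
of the strip. -/
theorem eq_of_degree_eq {n m : ℕ} {f d : ℕ →₀ ℕ} (h : ∀ x, x ≠ n → d x = f x)
    (hf : f n = 0) (hdeg : d.degree = f.degree + m) : d = Finsupp.single n m + f := by
  have h1 : d = Finsupp.single n (d n) + f := by
    ext x
    by_cases hx : x = n
    · subst hx
      simp [hf]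
    · simp [h x hx, Finsupp.single_eq_of_ne hx]
  have h2 : d n = m := by
    rw [h1, map_add, Finsupp.degree_single] at hdeg
    omega
  rw [h1, h2]

theorem content_extendTableau {κ μ : YoungDiagram} (h : IsHorizontalStrip κ μ) {n m : ℕ}
    (T : SemistandardYoungTableau μ) (hT : ∀ x ∈ (content T).support, x < n)
    (hcard : κ.card = μ.card + m) :
    content (extendTableau h n T hT) = Finsupp.single n m + content T := by
  refine eq_of_degree_eq (fun x hx => ?_) ?_ (by rw [degree_content, degree_content, hcard])
  · rw [content_apply, content_apply]
    congr 1
    ext ⟨i, j⟩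
    have hsub := @subset_of_isHorizontalStrip _ _ h (i, j)
    simp only [YoungDiagram.mem_cells] at hsub
    simp only [Finset.mem_filter, YoungDiagram.mem_cells, extendTableau_apply]
    constructor
    · rintro ⟨h1, h2⟩
      split_ifs at h2 with h3
      · exact ⟨h3, h2⟩
      · exact absurd h2.symm hx
    · rintro ⟨h1, h2⟩
      rw [if_pos h1]
      exact ⟨hsub h1, h2⟩
  · by_contra hne
    exact lt_irrefl _ (hT n (Finsupp.mem_support_iff.2 hne))

theorem content_restrictTableau {κ : YoungDiagram} (T : SemistandardYoungTableau κ) {n m : ℕ}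
    {f : ℕ →₀ ℕ} (hf : ∀ x ∈ f.support, x < n) (hT : content T = Finsupp.single n m + f) :
    content (restrictTableau T n) = f := by
  ext x
  rw [content_apply]
  rcases lt_or_ge x n with hx | hx
  · have h1 : content T x = f x := by
      rw [hT, Finsupp.add_apply, Finsupp.single_eq_of_ne hx.ne, zero_add]
    rw [← h1, content_apply]
    congr 1
    ext ⟨i, j⟩
    rw [Finset.mem_filter, Finset.mem_filter, YoungDiagram.mem_cells, YoungDiagram.mem_cells,
      restrictTableau_apply]
    constructor
    · rintro ⟨h1, h2⟩
      rw [if_pos h1] at h2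
      exact ⟨(mem_restrictShape.1 h1).1, h2⟩
    · rintro ⟨h1, h2⟩
      have h3 := mem_restrictShape.2 ⟨h1, h2.trans_lt hx⟩
      rw [if_pos h3]
      exact ⟨h3, h2⟩
  · have h1 : f x = 0 := by
      by_contra hne
      exact (hf x (Finsupp.mem_support_iff.2 hne)).not_ge hx
    rw [h1, Finset.card_eq_zero, Finset.filter_eq_empty_iff]
    rintro ⟨i, j⟩ hc h2
    rw [YoungDiagram.mem_cells] at hc
    rw [restrictTableau_apply, if_pos hc] at h2
    have := (mem_restrictShape.1 hc).2
    dsimp only at h2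
    omega

/-- Erasing the `m` largest entries `n` leaves a tableau on a shape whose complement is a horizontal
strip of size `m`; filling the strip with `n` is the inverse. -/
theorem card_tableaux_branching (κ : YoungDiagram) {n : ℕ} (m : ℕ) {f : ℕ →₀ ℕ}
    (hf : ∀ x ∈ f.support, x < n) :
    Nat.card {T : SemistandardYoungTableau κ // content T = Finsupp.single n m + f} =
      ∑ μ ∈ removeStrips m κ, Nat.card {T : SemistandardYoungTableau μ // content T = f} := by
  have := fun μ => finite_content_eq μ f
  rw [← Finset.sum_coe_sort, ← Nat.card_sigma]
  symm
  refine Nat.card_eq_of_bijective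
    (fun x : (μ : removeStrips m κ) × {T : SemistandardYoungTableau μ.1 // content T = f} =>
      (⟨extendTableau (mem_removeStrips.1 x.1.2).1 n x.2.1 (by rw [x.2.2]; exact hf), by
        rw [content_extendTableau _ _ _ (mem_removeStrips.1 x.1.2).2, x.2.2]⟩ :
      {T : SemistandardYoungTableau κ // content T = Finsupp.single n m + f})) ⟨?_, ?_⟩
  · rintro ⟨⟨μ₁, h₁⟩, T₁, hT₁⟩ ⟨⟨μ₂, h₂⟩, T₂, hT₂⟩ h
    have h' : ∀ i j, (if (i, j) ∈ μ₁ then T₁ i j else if (i, j) ∈ κ then n else 0) =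
        if (i, j) ∈ μ₂ then T₂ i j else if (i, j) ∈ κ then n else 0 := fun i j => by
      rw [← extendTableau_apply (mem_removeStrips.1 h₁).1 n T₁ (by rw [hT₁]; exact hf),
        ← extendTableau_apply (mem_removeStrips.1 h₂).1 n T₂ (by rw [hT₂]; exact hf)]
      exact congrArg (fun T : {T : SemistandardYoungTableau κ //
        content T = Finsupp.single n m + f} => T.1 i j) h
    -- The inner shape is recovered from the extended filling as the set of cells with entry below
    -- `n`.
    have hmem : ∀ {μ : YoungDiagram}, IsHorizontalStrip κ μ →
        ∀ T : SemistandardYoungTableau μ, content T = f → ∀ c : ℕ × ℕ, c ∈ μ ↔ c ∈ κ ∧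
        (if (c.1, c.2) ∈ μ then T c.1 c.2 else if (c.1, c.2) ∈ κ then n else 0) < n := by
      rintro μ hμ T hT ⟨i, j⟩
      constructor
      · intro hc
        have hc' := subset_of_isHorizontalStrip hμ ((YoungDiagram.mem_cells _).2 hc)
        refine ⟨(YoungDiagram.mem_cells _).1 hc', ?_⟩
        rw [if_pos hc]
        exact hf _ (hT ▸ entry_mem_support_content T hc)
      · rintro ⟨h1, h2⟩
        by_contra hc
        rw [if_neg hc, if_pos h1] at h2
        exact lt_irrefl _ h2
    have hμ : μ₁ = μ₂ := by
      ext c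
      rw [YoungDiagram.mem_cells, YoungDiagram.mem_cells, hmem (mem_removeStrips.1 h₁).1 T₁ hT₁,
        hmem (mem_removeStrips.1 h₂).1 T₂ hT₂, h']
    subst hμ
    have hT : T₁ = T₂ := by
      ext i j
      by_cases hc : (i, j) ∈ μ₁
      · simpa [hc] using h' i j
      · rw [T₁.zeros hc, T₂.zeros hc]
    subst hT
    rfl
  · rintro ⟨T, hT⟩
    have hle : ∀ x ∈ (content T).support, x ≤ n := fun x hx => by
      by_contra! hlt
      rw [Finsupp.mem_support_iff, hT, Finsupp.add_apply, Finsupp.single_eq_of_ne hlt.ne',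
        zero_add, ← Finsupp.mem_support_iff] at hx
      exact hlt.not_gt (hf x hx)
    have hs := isHorizontalStrip_restrictShape T hle
    have hc := content_restrictTableau T hf hT
    refine ⟨⟨⟨restrictShape T n, mem_removeStrips.2 ⟨hs, ?_⟩⟩, restrictTableau T n, hc⟩, ?_⟩
    · rw [← degree_content T, hT, map_add, Finsupp.degree_single,
        ← degree_content (restrictTableau T n), hc, add_comm]
    · apply Subtype.ext
      ext i j
      dsimp only
      rw [extendTableau_apply, restrictTableau_apply]
      split_ifs with h1 h2
      · rfl
      · have h3 := hle _ (entry_mem_support_content T h2)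
        have h4 : ¬ T i j < n := fun h => h1 (mem_restrictShape.2 ⟨h2, h⟩)
        omega
      · exact (T.zeros h2).symm

end Branching

/-! ### Pieri's rule and linear independence of Schur functions -/

section Pieri

/-- The linear map that sends a formal combination of diagrams to the corresponding combination of
Schur functions. -/
noncomputable def schurMap : (YoungDiagram →₀ ℤ) →ₗ[ℤ] MvPowerSeries ℕ ℤ :=
  Finsupp.linearCombination ℤ schur

@[simp]
theorem schurMap_single (μ : YoungDiagram) : schurMap (Finsupp.single μ 1) = schur μ := by
  simp [schurMap]

theorem coeff_schur (d : ℕ →₀ ℕ) (μ : YoungDiagram) : MvPowerSeries.coeff d (schur μ) =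
    (Nat.card {T : SemistandardYoungTableau μ // content T = d} : ℤ) := rfl

/-- The coefficient of a monomial in a combination of Schur functions, as a linear functional. -/
noncomputable def schurCoeff (d : ℕ →₀ ℕ) : (YoungDiagram →₀ ℤ) →ₗ[ℤ] ℤ :=
  (MvPowerSeries.coeff (R := ℤ) d).toAddMonoidHom.toIntLinearMap ∘ₗ schurMap

theorem schurCoeff_apply (d : ℕ →₀ ℕ) (b : YoungDiagram →₀ ℤ) :
    schurCoeff d b = MvPowerSeries.coeff d (schurMap b) := rfl

theorem coeff_schurMap_single_add {n : ℕ} (m : ℕ) {f : ℕ →₀ ℕ} (hf : ∀ x ∈ f.support, x < n)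
    (b : YoungDiagram →₀ ℤ) :
    MvPowerSeries.coeff (Finsupp.single n m + f) (schurMap b) =
      MvPowerSeries.coeff f (schurMap (removeOp m b)) := by
  refine linearMap_ext (f := schurCoeff (Finsupp.single n m + f))
    (g := schurCoeff f ∘ₗ removeOp m) (fun κ => ?_) b
  simp only [LinearMap.comp_apply, removeOp_single, map_sum, schurCoeff_apply, schurMap_single, coeff_schur]
  rw [card_tableaux_branching κ m hf, Nat.cast_sum]

theorem eq_bot_of_card_eq_zero {μ : YoungDiagram} (h : μ.card = 0) : μ = ⊥ :=
  YoungDiagram.ext (Finset.card_eq_zero.1 h)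

theorem card_bot : (⊥ : YoungDiagram).card = 0 := Finset.card_empty

theorem coeff_zero_schurMap (b : YoungDiagram →₀ ℤ) :
    MvPowerSeries.coeff 0 (schurMap b) = b ⊥ := by
  classical
  refine linearMap_ext  (f := schurCoeff 0) (g := Finsupp.lapply ⊥) (fun μ => ?_) b
  rw [schurCoeff_apply, schurMap_single, coeff_schur, Finsupp.lapply_apply,
    Finsupp.single_apply]
  split_ifs with h
  · subst h
    rw [Nat.cast_eq_one, Nat.card_eq_one_iff_unique]
    refine ⟨⟨fun T₁ T₂ => Subtype.ext ?_⟩, ⟨default, ?_⟩⟩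
    · ext i j
      rw [T₁.1.zeros (YoungDiagram.notMem_bot _), T₂.1.zeros (YoungDiagram.notMem_bot _)]
    · rw [← Finsupp.degree_eq_zero_iff, degree_content, card_bot]
  · rw [Nat.cast_eq_zero]
    have : IsEmpty {T : SemistandardYoungTableau μ // content T = 0} := ⟨fun T => h
      (eq_bot_of_card_eq_zero (by rw [← degree_content T.1, T.2, map_zero]))⟩
    exact Nat.card_of_isEmpty

/-- The complete homogeneous symmetric function of degree `k`. -/
noncomputable def completeHomogeneous (k : ℕ) : MvPowerSeries ℕ ℤ :=
  fun d => if d.degree = k then 1 else 0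

theorem coeff_completeHomogeneous (k : ℕ) (d : ℕ →₀ ℕ) :
    MvPowerSeries.coeff d (completeHomogeneous k) = if d.degree = k then 1 else 0 := rfl

/-- Factoring a monomial splits into factoring its power of `x_n` and factoring the rest
independently. -/
theorem sum_antidiagonal_single_add {M : Type*} [AddCommMonoid M] {n : ℕ} (m : ℕ) {f : ℕ →₀ ℕ}
    (hf : f n = 0) (F : (ℕ →₀ ℕ) → (ℕ →₀ ℕ) → M) :
    ∑ p ∈ Finset.HasAntidiagonal.antidiagonal (Finsupp.single n m + f), F p.1 p.2 =
      ∑ q ∈ Finset.HasAntidiagonal.antidiagonal m, ∑ p ∈ Finset.HasAntidiagonal.antidiagonal f,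
        F (Finsupp.single n q.1 + p.1) (Finsupp.single n q.2 + p.2) := by
  rw [← Finset.sum_product']
  symm
  refine Finset.sum_bij'
    (fun x _ => (Finsupp.single n x.1.1 + x.2.1, Finsupp.single n x.1.2 + x.2.2))
    (fun p _ => ((p.1 n, p.2 n), (p.1.erase n, p.2.erase n))) ?_ ?_ ?_ ?_ (fun _ _ => rfl)
  · rintro ⟨⟨q₁, q₂⟩, p₁, p₂⟩ h
    simp only [Finset.mem_product, Finset.HasAntidiagonal.mem_antidiagonal] at h ⊢
    rw [← h.1, ← h.2, Finsupp.single_add]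
    exact add_add_add_comm _ _ _ _
  · rintro ⟨p₁, p₂⟩ h
    simp only [Finset.mem_product, Finset.HasAntidiagonal.mem_antidiagonal] at h ⊢
    constructor
    · rw [← Finsupp.add_apply, h]
      simp [hf]
    · rw [← Finsupp.erase_add, h, Finsupp.erase_add, Finsupp.erase_single, zero_add,
        Finsupp.erase_of_notMem_support (by simpa using hf)]
  · rintro ⟨⟨q₁, q₂⟩, p₁, p₂⟩ h
    simp only [Finset.mem_product, Finset.HasAntidiagonal.mem_antidiagonal] at h
    have h1 := congrArg (· n) h.2
    simp only [Finsupp.add_apply, hf, Nat.add_eq_zero_iff] at h1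
    simp only [Finsupp.add_apply, Finsupp.single_eq_same, h1.1, h1.2, add_zero, Finsupp.erase_add,
      Finsupp.erase_single, zero_add]
    rw [Finsupp.erase_of_notMem_support (by simpa using h1.1),
      Finsupp.erase_of_notMem_support (by simpa using h1.2)]
  · rintro ⟨p₁, p₂⟩ -
    simp only [Finsupp.single_add_erase]

/-- Pieri's rule. -/
theorem schurMap_addOp (k : ℕ) (b : YoungDiagram →₀ ℤ) :
    schurMap (addOp k b) = completeHomogeneous k * schurMap b := by
  classical
  ext d
  symm
  -- Peeling off the largest variable replaces `k` and `b` by `k - q.1` and `removeOp q.2 b`, so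
  -- both must vary in the induction.
  induction d using Finsupp.induction_on_max generalizing k b with
  | zero =>
    rw [MvPowerSeries.coeff_mul, Finsupp.antidiagonal_zero, Finset.sum_singleton,
      coeff_completeHomogeneous, coeff_zero_schurMap, coeff_zero_schurMap]
    refine linearMap_ext (f := (if (0 : ℕ →₀ ℕ).degree = k then (1 : ℤ) else 0) • Finsupp.lapply ⊥)
      (g := Finsupp.lapply ⊥ ∘ₗ addOp k) (fun μ => ?_) b
    have h : ⊥ ∈ addStrips k μ ↔ 0 = k ∧ μ = ⊥ := by
      rw [mem_addStrips, card_bot]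
      constructor
      · rintro ⟨-, h⟩
        exact ⟨by omega, eq_bot_of_card_eq_zero (by omega)⟩
      · rintro ⟨rfl, rfl⟩
        refine ⟨fun i => ⟨le_rfl, YoungDiagram.rowLen_anti _ _ _ (Nat.le_succ i)⟩, ?_⟩
        rw [card_bot]
    rw [LinearMap.smul_apply, LinearMap.comp_apply, Finsupp.lapply_apply, Finsupp.lapply_apply,
      addOp_single_apply, Finsupp.single_apply, map_zero, smul_eq_mul, ite_zero_mul_ite_zero,
      mul_one]
    exact if_congr h.symm rfl rfl
  | single_add n m f hf hm ih =>
    have hfn : f n = 0 := by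
      by_contra h
      exact lt_irrefl _ (hf n (Finsupp.mem_support_iff.2 h))
    rw [coeff_schurMap_single_add m hf, removeOp_addOp, map_sum, map_sum, MvPowerSeries.coeff_mul,
      sum_antidiagonal_single_add m hfn fun p q => MvPowerSeries.coeff p (completeHomogeneous k) *
        MvPowerSeries.coeff q (schurMap b)]
    have hterm : ∀ q ∈ Finset.HasAntidiagonal.antidiagonal m, ∑ p ∈ Finset.HasAntidiagonal.antidiagonal f,
        MvPowerSeries.coeff (Finsupp.single n q.1 + p.1) (completeHomogeneous k) *
          MvPowerSeries.coeff (Finsupp.single n q.2 + p.2) (schurMap b) =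
        if q.1 ≤ k then
          MvPowerSeries.coeff f (schurMap (addOp (k - q.1) (removeOp q.2 b))) else 0 := by
      intro q _
      have hlt : ∀ p ∈ Finset.HasAntidiagonal.antidiagonal f, ∀ x ∈ p.2.support, x < n := fun p hp x hx => by
        refine hf x ?_
        rw [Finsupp.mem_support_iff, ← Finset.HasAntidiagonal.mem_antidiagonal.1 hp, Finsupp.add_apply]
        have := Finsupp.mem_support_iff.1 hx
        omega
      split_ifs with hq
      · rw [← ih, MvPowerSeries.coeff_mul]
        refine Finset.sum_congr rfl fun p hp => ?_
        rw [coeff_schurMap_single_add _ (hlt p hp), coeff_completeHomogeneous,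
          coeff_completeHomogeneous, map_add, Finsupp.degree_single]
        congr 1
        exact if_congr (by omega) rfl rfl
      · refine Finset.sum_eq_zero fun p _ => ?_
        rw [coeff_completeHomogeneous, map_add, Finsupp.degree_single, if_neg (by omega), zero_mul]
    rw [Finset.sum_congr rfl hterm, Finset.Nat.sum_antidiagonal_eq_sum_range_succ
      (fun i j => if i ≤ k then
        MvPowerSeries.coeff f (schurMap (addOp (k - i) (removeOp j b))) else 0)]
    symm
    -- The commutation relation stops at `min m k`; the remaining terms, with index beyond `k`,
    -- vanish.
    refine Finset.sum_subset_zero_on_sdiff (fun j hj => ?_) (fun j hj => ?_) (fun j hj => ?_)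
    · rw [Finset.mem_range] at hj ⊢
      omega
    · rw [Finset.mem_sdiff, Finset.mem_range, Finset.mem_range] at hj
      rw [if_neg (by omega)]
    · rw [Finset.mem_range] at hj
      rw [if_pos (by omega)]

/-- Each coefficient after removal is a coefficient before removal, at a monomial with a new
variable larger than those of `f`. -/
theorem schurMap_removeOp_eq_zero {b : YoungDiagram →₀ ℤ} (hb : schurMap b = 0) (k : ℕ) :
    schurMap (removeOp k b) = 0 := by
  ext f
  have hf : ∀ x ∈ f.support, x < f.support.sup id + 1 := fun x hx =>
    Nat.lt_succ_of_le (Finset.le_sup (f := id) hx)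
  rw [← coeff_schurMap_single_add k hf, hb, map_zero, map_zero]

/-- Schur functions are linearly independent. -/
theorem schurMap_injective : Function.Injective schurMap := by
  rw [← LinearMap.ker_eq_bot, LinearMap.ker_eq_bot']
  intro b hb
  -- `W` is the orthogonal complement of the kernel. It contains `⊥` by constant terms, and
  -- adjointness makes it stable under `addOp` because the kernel is stable under `removeOp`; so it
  -- is everything.
  let W : Submodule ℤ (YoungDiagram →₀ ℤ) :=
    ⨅ b ∈ LinearMap.ker schurMap, LinearMap.ker (Finsupp.linearCombination ℤ b)
  have hW : ∀ {a}, a ∈ W ↔ ∀ b, schurMap b = 0 → Finsupp.linearCombination ℤ b a = 0 := by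
    simp [W]
  have htop : W = ⊤ := by
    refine eq_top_of_addOp_mem (hW.2 fun b hb => ?_) fun k a ha => hW.2 fun b hb => ?_
    · rw [Finsupp.linearCombination_single, one_smul, ← coeff_zero_schurMap, hb, map_zero]
    · rw [linearCombination_addOp]
      exact hW.1 ha _ (schurMap_removeOp_eq_zero hb k)
  ext μ
  have h := hW.1 (htop ▸ Submodule.mem_top : Finsupp.single μ 1 ∈ W) b hb
  simpa using h

end Pieri

/-! ### Conjugation is multiplicative and preserves Schur positivity -/

section Involution

theorem addStrips_zero (μ : YoungDiagram) : addStrips 0 μ = {μ} := by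
  ext κ
  rw [mem_addStrips, Finset.mem_singleton]
  constructor
  · rintro ⟨h1, h2⟩
    exact (YoungDiagram.ext (Finset.eq_of_subset_of_card_le (subset_of_isHorizontalStrip h1)
      h2.le)).symm
  · rintro rfl
    exact ⟨fun i => ⟨le_rfl, κ.rowLen_anti _ _ (Nat.le_succ i)⟩, rfl⟩

theorem addOp_zero (b : YoungDiagram →₀ ℤ) : addOp 0 b = b :=
  linearMap_ext (g := LinearMap.id) (fun μ => by
    rw [addOp_single, addStrips_zero, Finset.sum_singleton, LinearMap.id_apply]) b

/-- Adding vertical strips of size `k` is multiplication by a fixed symmetric function. -/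
theorem exists_schurMap_conj_addOp_conj (k : ℕ) :
    ∃ e : MvPowerSeries ℕ ℤ, ∀ b, schurMap (conj (addOp k (conj b))) = e * schurMap b := by
  induction k using Nat.strong_induction_on with
  | _ k ih =>
    rcases Nat.eq_zero_or_pos k with rfl | hk
    · exact ⟨1, fun b => by rw [addOp_zero, conj_conj, one_mul]⟩
    choose! e he using ih
    -- This solves the alternating relation for its term `i = 0`, the only one with vertical strips
    -- of full size `k`.
    refine ⟨-∑ i ∈ Finset.range k,
      (-1 : ℤ) ^ (i + 1) • (e (k - (i + 1)) * completeHomogeneous (i + 1)), fun b => ?_⟩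
    have h := congrArg schurMap (alternating_sum_conj_addOp hk b)
    rw [Finset.sum_range_succ', addOp_zero, pow_zero, one_smul, Nat.sub_zero, map_add, map_zero,
      map_sum] at h
    rw [eq_neg_of_add_eq_zero_right h, neg_mul, Finset.sum_mul]
    refine congrArg _ (Finset.sum_congr rfl fun i hi => ?_)
    rw [map_smul, he _ (by omega), schurMap_addOp, smul_mul_assoc, mul_assoc]

/-- Products of combinations of Schur functions are combinations of Schur functions, compatibly with
conjugation. -/
theorem exists_schurMap_mul (a b : YoungDiagram →₀ ℤ) :
    ∃ c, schurMap a * schurMap b = schurMap c ∧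
      schurMap (conj a) * schurMap (conj b) = schurMap (conj c) := by
  let W : Submodule ℤ (YoungDiagram →₀ ℤ) :=
    { carrier := {a | ∀ b, ∃ c, schurMap a * schurMap b = schurMap c ∧
        schurMap (conj a) * schurMap (conj b) = schurMap (conj c)}
      zero_mem' := fun b => ⟨0, by simp⟩
      add_mem' := fun {a₁ a₂} h₁ h₂ b => by
        obtain ⟨c₁, h1, h2⟩ := h₁ b
        obtain ⟨c₂, h3, h4⟩ := h₂ b
        refine ⟨c₁ + c₂, ?_, ?_⟩
        · rw [map_add, map_add, add_mul, h1, h3]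
        · rw [map_add, map_add, map_add, map_add, add_mul, h2, h4]
      smul_mem' := fun n a h b => by
        obtain ⟨c, h1, h2⟩ := h b
        refine ⟨n • c, ?_, ?_⟩
        · rw [map_smul, map_smul, smul_mul_assoc, h1]
        · rw [map_smul, map_smul, map_smul, map_smul, smul_mul_assoc, h2] }
  have htop : W = ⊤ := by
    -- The empty diagram gives the unit. In the step `addOp k c` serves both identities: Pieri's
    -- rule for the first, its vertical counterpart for the second.
    refine eq_top_of_addOp_mem (fun b => ⟨b, ?_⟩) fun k a ha b => ?_
    · have h1 : schurMap (Finsupp.single ⊥ 1) = 1 := by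
        classical
        ext d
        rw [schurMap_single, coeff_schur, MvPowerSeries.coeff_one]
        have hbot : ∀ T : SemistandardYoungTableau ⊥, content T = 0 := fun T => by
          rw [← Finsupp.degree_eq_zero_iff, degree_content, card_bot]
        split_ifs with h
        · rw [h, ← coeff_schur, ← schurMap_single, coeff_zero_schurMap, Finsupp.single_eq_same]
        · have : IsEmpty {T : SemistandardYoungTableau ⊥ // content T = d} :=
            ⟨fun T => h (T.2.symm.trans (hbot T.1))⟩
          rw [Nat.card_of_isEmpty, Nat.cast_zero]
      have h2 : (⊥ : YoungDiagram).transpose = ⊥ :=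
        eq_bot_of_card_eq_zero (by rw [card_transpose, card_bot])
      rw [conj_single, h2, h1, one_mul, one_mul]
      exact ⟨rfl, rfl⟩
    · obtain ⟨c, h1, h2⟩ := ha b
      obtain ⟨e, he⟩ := exists_schurMap_conj_addOp_conj k
      refine ⟨addOp k c, ?_, ?_⟩
      · rw [schurMap_addOp, schurMap_addOp, mul_assoc, h1]
      · have h3 := he (conj a)
        have h4 := he (conj c)
        rw [conj_conj] at h3 h4
        rw [h3, h4, mul_assoc, h2]
  exact (htop ▸ Submodule.mem_top : a ∈ W) b

theorem schurPositive_iff {f : MvPowerSeries ℕ ℤ} :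
    SchurPositive f ↔ ∃ a : YoungDiagram →₀ ℤ, (∀ θ, 0 ≤ a θ) ∧ f = schurMap a := by
  constructor
  · rintro ⟨c, rfl⟩
    refine ⟨c.mapRange (Nat.cast : ℕ → ℤ) Nat.cast_zero, fun θ => ?_, ?_⟩
    · rw [Finsupp.mapRange_apply]
      exact Nat.cast_nonneg _
    · rw [schurMap, Finsupp.linearCombination_apply, Finsupp.sum_mapRange_index fun _ => by simp]
  · rintro ⟨a, ha, rfl⟩
    refine ⟨a.mapRange Int.toNat Int.toNat_zero, ?_⟩
    rw [schurMap, Finsupp.linearCombination_apply, Finsupp.sum_mapRange_index fun _ => by simp]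
    exact Finsupp.sum_congr fun θ _ => by rw [Int.toNat_of_nonneg (ha θ)]

theorem SchurPositive.transpose {α β γ δ : YoungDiagram}
    (h : SchurPositive (schur α * schur β - schur γ * schur δ)) :
    SchurPositive (schur α.transpose * schur β.transpose -
      schur γ.transpose * schur δ.transpose) := by
  obtain ⟨a, ha, hs⟩ := schurPositive_iff.1 h
  obtain ⟨c, h1, h2⟩ := exists_schurMap_mul (Finsupp.single α 1) (Finsupp.single β 1)
  obtain ⟨d, h3, h4⟩ := exists_schurMap_mul (Finsupp.single γ 1) (Finsupp.single δ 1)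
  simp only [conj_single, schurMap_single] at h1 h2 h3 h4
  refine schurPositive_iff.2 ⟨conj a, fun θ => ?_, ?_⟩
  · rw [conj_apply]
    exact ha _
  -- Linear independence identifies the non-negative expansion with the one coming from the
  -- products, the only one known to be compatible with conjugation.
  · have hcd : c - d = a := schurMap_injective (by rw [map_sub, ← h1, ← h3, hs])
    rw [← hcd, h2, h4, map_sub, map_sub]

theorem ConjectureHolds.transpose {μ ν : YoungDiagram} (h : ConjectureHolds μ ν) :
    ConjectureHolds ν.transpose μ.transpose := by
  intro lam rho hstar
  obtain ⟨rfl, rfl⟩ := Prod.mk.inj hstar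
  rw [starLeft_transpose, starRight_transpose, mul_comm (schur ν.transpose)]
  exact (h _ _ rfl).transpose

end Involution

end FFLP

theorem proposition2p2 (μ ν : YoungDiagram) :
    FFLP.ConjectureHolds μ ν ↔ FFLP.ConjectureHolds ν.transpose μ.transpose := by
  refine ⟨fun h => h.transpose, fun h => ?_⟩
  -- The operation `(μ, ν) ↦ (ν', μ')` is an involution, so one implication yields the other.
  have h1 := h.transpose
  rwa [YoungDiagram.transpose_transpose, YoungDiagram.transpose_transpose] at h1
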